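/- Let $T>0$ and let $A:\mathbb R\to\mathbb R$ be a $\mathcal C^1$, $T$-periodic function that has at least one zero in $[0,T]$ and satisfies $\min \dot A(t) > -\tfrac14$. Consider the normal form of the Abel equation of the second kind, $$x\,\dot x = A(t)+x ,$$ whose solutions on an interval are the differentiable functions $x$ satisfying the equation at every point of that interval. A function has constant sign if it is everywhere positive or everywhere negative, and nonconstant sign otherwise. A solution $x$ on $\mathbb R$ is called unstable if there are $t_0\in\mathbb R$ and $\varepsilon>0$ such that for every $\delta>0$ there is a solution $y$ on $[t_0,\infty)$ with $|y(t_0)-x(t_0)|<\delta$ and $|y(t)-x(t)|\ge\varepsilon$ for some $t\ge t_0$. Then the equation has at least one $T$-periodic solution $x^\ast:\mathbb R\to\mathbb R$ that has the sign of $-A$ (that is, for every $t$, $x^\ast(t)$ is positive, zero or negative according to whether $-A(t)$ is), that is $\mathcal C^1$, and that is unstable. Furthermore, if all the zeros of $A$ are simple (that is, $\dot A(t)\neq 0$ whenever $A(t)=0$), then $x^\ast$ has nonconstant sign and is the unique $T$-periodic solution on $\mathbb R$ with nonconstant sign. Additionally, if $\int_0^T A(t)\,dt=0$ (whether or not the zeros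 of $A$ are simple), then the equation has no periodic solution on $\mathbb R$, of any period, other than $x^\ast$. -/

import Mathlib

/-- `x` is a (classical) solution on the set `s` of the normal form `x ẋ = A(t) + x` of the Abel
equation of the second kind: `x` is differentiable on `s` and satisfies the equation at every point
of `s` (derivatives at boundary points of `s` are one-sided). -/
def IsAbelSolutionOn (A x : ℝ → ℝ) (s : Set ℝ) : Prop :=
  DifferentiableOn ℝ x s ∧ ∀ t ∈ s, x t * derivWithin x s t = A t + x t

/-- `x` is a solution of `x ẋ = A(t) + x` on the whole real line. -/
def IsAbelSolution (A x : ℝ → ℝ) : Prop :=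
  Differentiable ℝ x ∧ ∀ t, x t * deriv x t = A t + x t

/-- `x` has constant sign: it is everywhere positive or everywhere negative. -/
def HasConstantSign (x : ℝ → ℝ) : Prop :=
  (∀ t, 0 < x t) ∨ (∀ t, x t < 0)

/-- `x` is (Lyapunov) unstable as a solution of `x ẋ = A(t) + x`: for some initial time `t₀` and
some `ε > 0` there are, arbitrarily close to `x t₀`, initial values of solutions `y` on `[t₀, ∞)`
whose distance to `x` reaches `ε` at some later time. The solutions `y` are required to exist on
all of `[t₀, ∞)`, so that instability never means a mere failure of continuation. -/
def IsAbelUnstable (A x : ℝ → ℝ) : Prop :=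
  ∃ t₀ : ℝ, ∃ ε > 0, ∀ δ > 0, ∃ y : ℝ → ℝ,
    IsAbelSolutionOn A y (Set.Ici t₀) ∧ |y t₀ - x t₀| < δ ∧ ∃ t, t₀ ≤ t ∧ ε ≤ |y t - x t|

/-!
A solution of `x ẋ = A(t) + x` can vanish only at zeros of `A`, and the hypothesis `Ȧ > -1/4` makes
the curve `x = -2 A` a barrier: along it the direction field has slope `1/2 > -2 Ȧ`. Everything
rests on this barrier.

*Existence.* Where `A > 0`, forward solutions enter and stay in the region `-2 A ≤ x ≤ -ε A`, which
pinches to a point at the zeros of `A`. The solution there is obtained as a monotone limit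
(`exists_isPositiveBranch`): the positive part of `A` is replaced by itself plus `η > 0`, which
removes the singularity (`exists_regularized_solution`), the initial time is sent to `-∞` and `η`
to `0`. The substitution `(t, x) ↦ (-t, -x)`, which turns `A` into `-A(-t)`, reduces the set where
`A < 0` to this case. In terms of `u = -x / A` the equation reads `ẋ = 1 - 1 / u`, so `x` is `C¹` as
soon as `u` extends continuously to the zeros of `A`. Its limit at a zero with `Ȧ = α` is the
smaller positive root of `α u² + u = 1` (`IsPositiveBranch.eventually_abs_sub_le`); the other
positive root, if any, exceeds `2` and is excluded by the barrier.

*Uniqueness.* Two solutions with the sign of `-A` attract each other in the direction of time that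
leads away from a common zero, hence agree (`eq_of_sign_neg`); periodicity of `x` is the special
case of a translate. A solution which is positive at a time with `A ≥ 0` satisfies `x > -2 A`, hence
`ẋ ≥ 1/2`, ever after (`add_half_le_of_pos`). So it is not periodic, and every periodic solution,
of any period, has the sign of `-A`. The same growth gives instability: solutions started just
above a zero of `A` tend to infinity.
-/

namespace AbelSecondKind

open Set Filter Topology
open scoped NNReal

/-! ### Barriers and global solutions of Lipschitz equations -/

/-- `f` stays nonnegative if it cannot decrease over an interval on which it is negative: compare
`f b` with the value at the last time at which `f` is nonnegative. -/
theorem nonneg_of_barrier {f : ℝ → ℝ} {a b : ℝ} (hab : a ≤ b) (hf : ContinuousOn f (Icc a b))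
    (ha : 0 ≤ f a)
    (h : ∀ s t, a ≤ s → s < t → t ≤ b → (∀ r ∈ Ioc s t, f r < 0) → f s ≤ f t) : 0 ≤ f b := by
  by_contra! hb
  have hS : IsCompact (Icc a b ∩ f ⁻¹' Ici 0) :=
    isCompact_Icc.of_isClosed_subset (hf.preimage_isClosed_of_isClosed isClosed_Icc isClosed_Ici)
      inter_subset_left
  obtain ⟨s, ⟨hs, hfs⟩, hmax⟩ := hS.exists_isGreatest ⟨a, ⟨le_rfl, hab⟩, ha⟩
  have hfs' : 0 ≤ f s := hfs
  have hsb : s < b := lt_of_le_of_ne hs.2 (by rintro rfl; linarith)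
  refine absurd (h s b hs.1 hsb le_rfl fun r hr => ?_) (by linarith)
  by_contra! hr0
  exact absurd (hmax ⟨⟨hs.1.trans hr.1.le, hr.2⟩, hr0⟩) (not_le.2 hr.1)

theorem le_of_hasDerivAt_nonneg {f f' : ℝ → ℝ} {a b : ℝ} (hab : a ≤ b)
    (hf : ContinuousOn f (Icc a b)) (h : ∀ t ∈ Ioo a b, HasDerivAt f (f' t) t)
    (h0 : ∀ t ∈ Ioo a b, 0 ≤ f' t) : f a ≤ f b := by
  refine monotoneOn_of_deriv_nonneg (convex_Icc a b) hf ?_ ?_ ⟨le_rfl, hab⟩ ⟨hab, le_rfl⟩ hab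
  · rw [interior_Icc]
    exact fun t ht => (h t ht).differentiableAt.differentiableWithinAt
  · rw [interior_Icc]
    intro t ht
    rw [(h t ht).deriv]
    exact h0 t ht

theorem nonneg_of_deriv_barrier {f : ℝ → ℝ} {a b : ℝ} (hab : a ≤ b)
    (hf : ContinuousOn f (Icc a b)) (ha : 0 ≤ f a)
    (h : ∀ t ∈ Ioo a b, f t < 0 → ∃ c, HasDerivAt f c t ∧ 0 ≤ c) : 0 ≤ f b := by
  refine nonneg_of_barrier hab hf ha fun s t hs hst htb hneg => ?_
  have key : ∀ r ∈ Ioo s t, HasDerivAt f (deriv f r) r ∧ 0 ≤ deriv f r := by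
    intro r hr
    obtain ⟨c, hc, hc0⟩ := h r ⟨hs.trans_lt hr.1, hr.2.trans_le htb⟩ (hneg r ⟨hr.1, hr.2.le⟩)
    rw [hc.deriv]
    exact ⟨hc, hc0⟩
  exact le_of_hasDerivAt_nonneg hst.le (hf.mono (Icc_subset_Icc hs htb)) (fun r hr => (key r hr).1)
    fun r hr => (key r hr).2

/-- Solutions given by the Picard–Lindelöf theorem on the intervals `[t₀ - n - 1, t₀ + n + 1]`
agree on overlaps by uniqueness, so they glue to a solution on the whole line. -/
theorem exists_global_solution {f : ℝ → ℝ → ℝ} {L K : ℝ≥0} (hlip : ∀ t, LipschitzWith K (f t))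
    (hcont : ∀ x, Continuous fun t => f t x) (hb : ∀ t x, ‖f t x‖ ≤ L) (t₀ x₀ : ℝ) :
    ∃ x : ℝ → ℝ, x t₀ = x₀ ∧ ∀ t, HasDerivAt x (f t (x t)) t := by
  have hloc : ∀ n : ℕ, ∃ x : ℝ → ℝ, x t₀ = x₀ ∧
      ∀ t ∈ Ioo (t₀ - (n + 1)) (t₀ + (n + 1)), HasDerivAt x (f t (x t)) t := by
    intro n
    have hn : (0 : ℝ) < n + 1 := by positivity
    have hP : IsPicardLindelof f (tmin := t₀ - (n + 1)) (tmax := t₀ + (n + 1))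
        ⟨t₀, by constructor <;> linarith⟩ x₀ (L * (n + 1)) 0 L K :=
      { lipschitzOnWith := fun t _ => (hlip t).lipschitzOnWith
        continuousOn := fun x _ => (hcont x).continuousOn
        norm_le := fun t _ x _ => hb t x
        mul_max_le := by simp }
    obtain ⟨x, hx0, hx⟩ := hP.exists_eq_forall_mem_Icc_hasDerivWithinAt₀
    exact ⟨x, hx0, fun t ht => (hx t (Ioo_subset_Icc_self ht)).hasDerivAt (Icc_mem_nhds ht.1 ht.2)⟩
  choose X hX0 hX using hloc
  have hagree : ∀ m n : ℕ, m ≤ n → ∀ t ∈ Ioo (t₀ - (m + 1)) (t₀ + (m + 1)), X m t = X n t := by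
    intro m n hmn
    have hm : (0 : ℝ) < m + 1 := by positivity
    have hmn' : (m : ℝ) ≤ n := by exact_mod_cast hmn
    refine ODE_solution_unique_of_mem_Ioo (v := f) (s := fun _ => univ) (K := K) (t₀ := t₀)
      (fun t _ => (hlip t).lipschitzOnWith) ⟨by linarith, by linarith⟩
      (fun t ht => ⟨hX m t ht, trivial⟩) (fun t ht => ⟨hX n t ⟨?_, ?_⟩, trivial⟩)
      ((hX0 m).trans (hX0 n).symm)
    · linarith [ht.1]
    · linarith [ht.2]
  have hmem : ∀ t, t ∈ Ioo (t₀ - ((⌈|t - t₀|⌉₊ : ℝ) + 1)) (t₀ + ((⌈|t - t₀|⌉₊ : ℝ) + 1)) := by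
    intro t
    have := abs_le.1 (Nat.le_ceil |t - t₀|)
    constructor <;> linarith
  set x : ℝ → ℝ := fun t => X ⌈|t - t₀|⌉₊ t with hx
  have hxX : ∀ n : ℕ, ∀ t ∈ Ioo (t₀ - ((n : ℝ) + 1)) (t₀ + (n + 1)), x t = X n t := by
    intro n t ht
    rcases le_total ⌈|t - t₀|⌉₊ n with h | h
    · exact hagree _ _ h t (hmem t)
    · exact (hagree _ _ h t ht).symm
  refine ⟨x, (hxX 0 t₀ (by simp)).trans (hX0 0), fun t => ?_⟩
  have ht := hmem t
  rw [hxX _ t ht]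
  refine (hX _ t ht).congr_of_eventuallyEq ?_
  filter_upwards [Ioo_mem_nhds ht.1 ht.2] with s hs using hxX _ s hs

/-- Cutting off the denominator at a level `c > 0` makes the equation globally solvable. -/
theorem exists_truncated_solution {b : ℝ → ℝ} (hb : Continuous b) {M : ℝ} (hM : ∀ t, |b t| ≤ M)
    {c : ℝ} (hc : 0 < c) (σ t₀ x₀ : ℝ) :
    ∃ x : ℝ → ℝ, x t₀ = x₀ ∧ ∀ t, HasDerivAt x (σ + b t / max (x t) c) t := by
  have hM0 : 0 ≤ M := (abs_nonneg _).trans (hM 0)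
  have hpos : ∀ x : ℝ, 0 < max x c := fun x => lt_max_of_lt_right hc
  refine exists_global_solution (f := fun t x => σ + b t / max x c)
    (K := NNReal.mk (M / (c * c)) (by positivity))
    (L := NNReal.mk (|σ| + M / c) (by positivity)) ?_ ?_ ?_ t₀ x₀
  · intro t
    refine LipschitzWith.of_dist_le_mul fun x y => ?_
    rw [Real.dist_eq, Real.dist_eq, NNReal.coe_mk]
    have h1 : σ + b t / max x c - (σ + b t / max y c)
        = b t * (max y c - max x c) / (max x c * max y c) := by
      field_simp [(hpos x).ne', (hpos y).ne']
      ring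
    have h2 : |max y c - max x c| ≤ |x - y| := by
      rw [abs_sub_comm x y]
      exact abs_max_sub_max_le_abs y x c
    rw [h1, abs_div, abs_mul, abs_of_pos (mul_pos (hpos x) (hpos y)), div_mul_eq_mul_div]
    refine div_le_div₀ (by positivity) (mul_le_mul (hM t) h2 (abs_nonneg _) hM0) (by positivity) ?_
    exact mul_le_mul (le_max_right _ _) (le_max_right _ _) hc.le (hpos x).le
  · intro x
    exact continuous_const.add (hb.div_const _)
  · intro t x
    rw [NNReal.coe_mk, Real.norm_eq_abs]
    refine (abs_add_le _ _).trans (add_le_add le_rfl ?_)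
    rw [abs_div, abs_of_pos (hpos x)]
    exact div_le_div₀ hM0 (hM t) hc (le_max_right _ _)

/-- The equation `Ẋ = (B + η) / X - 1` is nonsingular for `η > 0`, and its solutions started at a
zero of `B` remain in the region between `(1 / (1 + M)) (B + η)` and `2 (B + η)`. Only one-sided
slope bounds on `B` are used, because the positive part of `A` need not be differentiable. -/
theorem exists_regularized_solution {B : ℝ → ℝ} (hB : Continuous B) (hB0 : ∀ t, 0 ≤ B t) {M : ℝ}
    (hM : ∀ t, B t ≤ M) (hdown : ∀ s t, s ≤ t → B s - (t - s) / 4 ≤ B t)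
    (hup : ∀ s t, s ≤ t → B t ≤ B s + M * (t - s)) {η : ℝ} (hη : 0 < η) {s : ℝ} (hs : B s = 0) :
    ∃ X : ℝ → ℝ, X s = 2 * η ∧ ∀ t, s ≤ t → (1 / (1 + M)) * (B t + η) ≤ X t ∧
      X t ≤ 2 * (B t + η) ∧ HasDerivAt X (-1 + (B t + η) / X t) t := by
  have hM0 : 0 ≤ M := (hB0 s).trans (hM s)
  set ε : ℝ := 1 / (1 + M) with hε
  have hε0 : 0 < ε := by positivity
  have hε1 : ε ≤ 1 := by rw [hε, div_le_one (by positivity)]; linarith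
  have hεM : ε * (1 + M) = 1 := by rw [hε]; field_simp
  obtain ⟨X, hXs, hX⟩ := exists_truncated_solution (b := fun t => B t + η)
    (hB.add continuous_const) (M := M + η)
    (fun t => by rw [abs_of_nonneg (by linarith [hB0 t])]; linarith [hM t])
    (c := ε * η) (by positivity) (-1) s (2 * η)
  have hXc : Continuous X := continuous_iff_continuousAt.2 fun t => (hX t).continuousAt
  -- Where `X < ε (B + η)` the field is at least `1 / ε - 1 = M`, above the slope of the barrier.
  have hlow : ∀ t, s ≤ t → ε * (B t + η) ≤ X t := by
    intro t hst
    have := nonneg_of_barrier (f := fun t => X t - ε * (B t + η)) hst (by fun_prop)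
      (by simp only [hXs, hs]; nlinarith) ?_
    · simpa using this
    intro p q hp hpq hq hneg
    have hslope : M * (q - p) ≤ X q - X p := by
      have := le_of_hasDerivAt_nonneg (f := fun t => X t - M * t)
        (f' := fun t => -1 + (B t + η) / max (X t) (ε * η) - M * 1) hpq.le (by fun_prop)
        (fun r _ => (hX r).sub ((hasDerivAt_id r).const_mul M)) (fun r hr => ?_)
      · linarith
      have hr' : X r - ε * (B r + η) < 0 := hneg r ⟨hr.1, hr.2.le⟩
      have hmax : max (X r) (ε * η) ≤ ε * (B r + η) :=
        max_le (by linarith) (mul_le_mul_of_nonneg_left (by linarith [hB0 r]) hε0.le)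
      have : 1 + M ≤ (B r + η) / max (X r) (ε * η) := by
        rw [le_div_iff₀ (lt_max_of_lt_right (by positivity))]
        calc (1 + M) * max (X r) (ε * η) ≤ (1 + M) * (ε * (B r + η)) := by gcongr
          _ = ε * (1 + M) * (B r + η) := by ring
          _ = B r + η := by rw [hεM, one_mul]
      linarith
    have h2 := hup p q hpq.le
    have h3 : ε * (B q - B p) ≤ M * (q - p) := by
      have : ε * (B q - B p) ≤ ε * (M * (q - p)) :=
        mul_le_mul_of_nonneg_left (by linarith) hε0.le
      have h4 : ε * (M * (q - p)) ≤ 1 * (M * (q - p)) :=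
        mul_le_mul_of_nonneg_right hε1 (mul_nonneg hM0 (by linarith))
      linarith
    linarith
  have hmax : ∀ t, s ≤ t → max (X t) (ε * η) = X t := by
    intro t hst
    refine max_eq_left (le_trans ?_ (hlow t hst))
    exact mul_le_mul_of_nonneg_left (by linarith [hB0 t]) hε0.le
  have hX0 : ∀ t, s ≤ t → 0 < X t := fun t hst =>
    lt_of_lt_of_le (mul_pos hε0 (by linarith [hB0 t])) (hlow t hst)
  have hX' : ∀ t, s ≤ t → HasDerivAt X (-1 + (B t + η) / X t) t := by
    intro t hst
    have := hX t
    rwa [hmax t hst] at this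
  -- Where `X > 2 (B + η)` the field is below `-1 / 2`, the least slope of the barrier.
  have hupp : ∀ t, s ≤ t → X t ≤ 2 * (B t + η) := by
    intro t hst
    have := nonneg_of_barrier (f := fun t => 2 * (B t + η) - X t) hst (by fun_prop)
      (by simp only [hXs, hs]; linarith) ?_
    · simpa using this
    intro p q hp hpq hq hneg
    have hslope : X q - X p ≤ -(1 / 2) * (q - p) := by
      have := le_of_hasDerivAt_nonneg (f := fun t => -(1 / 2) * t - X t)
        (f' := fun t => -(1 / 2) * 1 - (-1 + (B t + η) / X t)) hpq.le (by fun_prop)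
        (fun r hr => ((hasDerivAt_id r).const_mul _).sub (hX' r (hp.trans hr.1.le)))
        (fun r hr => ?_)
      · linarith
      have hr' : 2 * (B r + η) - X r < 0 := hneg r ⟨hr.1, hr.2.le⟩
      have : (B r + η) / X r ≤ 1 / 2 := by
        rw [div_le_iff₀ (hX0 r (hp.trans hr.1.le))]; linarith
      linarith
    have h2 := hdown p q hpq.le
    linarith
  exact ⟨X, hXs, fun t hst => ⟨hlow t hst, hupp t hst, hX' t hst⟩⟩

/-! ### The branch of the solution over the positive part of `A` -/

/-- `X` is the mirror image `-x` of a nonpositive solution `x` of `x ẋ = A(t) + x` over the set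
where `A` is positive, extended by zero: it vanishes where `A ≤ 0`, solves `Ẋ = A / X - 1` where
`A > 0`, and is comparable to the positive part of `A`, with ratio at most `2`. -/
structure IsPositiveBranch (A X : ℝ → ℝ) (ε : ℝ) : Prop where
  continuous : Continuous X
  lower : ∀ t, ε * max (A t) 0 ≤ X t
  upper : ∀ t, X t ≤ 2 * max (A t) 0
  hasDerivAt : ∀ t, 0 < A t → HasDerivAt X (A t / X t - 1) t

theorem exists_bound_of_periodic {A : ℝ → ℝ} {T : ℝ} (hT : 0 < T) (hA : ContDiff ℝ 1 A)
    (hper : Function.Periodic A T) : ∃ M, ∀ t, |A t| ≤ M ∧ |deriv A t| ≤ M := by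
  have hper' : Function.Periodic (deriv A) T := fun t => by
    rw [← deriv_comp_add_const]
    exact congrArg (fun f => deriv f t) (funext hper)
  obtain ⟨M₁, h₁⟩ := (hper.isBounded_of_continuous hT.ne' hA.continuous).exists_norm_le
  obtain ⟨M₂, h₂⟩ :=
    (hper'.isBounded_of_continuous hT.ne' (hA.continuous_deriv le_rfl)).exists_norm_le
  exact ⟨max M₁ M₂, fun t => ⟨(h₁ _ ⟨t, rfl⟩).trans (le_max_left _ _),
    (h₂ _ ⟨t, rfl⟩).trans (le_max_right _ _)⟩⟩

/-- The limit is antitone in the regularization: the `n`-th approximation starts `n` periods before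
the zero `z`, and it dominates all later ones from its starting time on. -/
theorem exists_isPositiveBranch {A : ℝ → ℝ} {T z : ℝ} (hT : 0 < T) (hA : ContDiff ℝ 1 A)
    (hper : Function.Periodic A T) (hz : A z = 0) (hmin : ∀ t, -(1 / 4 : ℝ) < deriv A t) :
    ∃ X : ℝ → ℝ, ∃ ε > 0, IsPositiveBranch A X ε := by
  obtain ⟨M, hM⟩ := exists_bound_of_periodic hT hA hper
  have hM0 : 0 ≤ M := (abs_nonneg _).trans (hM 0).1
  have hAc := hA.continuous
  have hAd : ∀ t, HasDerivAt A (deriv A t) t := fun t =>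
    (hA.differentiable one_ne_zero t).hasDerivAt
  set B : ℝ → ℝ := fun t => max (A t) 0 with hBdef
  have hBc : Continuous B := hAc.max continuous_const
  have hB0 : ∀ t, 0 ≤ B t := fun t => le_max_right _ _
  have hBM : ∀ t, B t ≤ M := fun t => max_le ((le_abs_self _).trans (hM t).1) hM0
  have hdown : ∀ s t, s ≤ t → B s - (t - s) / 4 ≤ B t := by
    intro s t hst
    have := le_of_hasDerivAt_nonneg (f := fun t => A t + 1 / 4 * t)
      (f' := fun t => deriv A t + 1 / 4 * 1) hst (by fun_prop)
      (fun r _ => (hAd r).add ((hasDerivAt_id r).const_mul _)) (fun r _ => by linarith [hmin r])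
    have h2 : A t ≤ B t := le_max_left _ _
    have h3 := hB0 t
    have : B s ≤ B t + (t - s) / 4 := max_le (by linarith) (by linarith)
    linarith
  have hup : ∀ s t, s ≤ t → B t ≤ B s + M * (t - s) := by
    intro s t hst
    have := le_of_hasDerivAt_nonneg (f := fun t => M * t - A t)
      (f' := fun t => M * 1 - deriv A t) hst (by fun_prop)
      (fun r _ => ((hasDerivAt_id r).const_mul _).sub (hAd r))
      (fun r _ => by linarith [(abs_le.1 (hM r).2).2])
    have h2 : A s ≤ B s := le_max_left _ _
    have h3 := hB0 s
    have h4 := mul_nonneg hM0 (sub_nonneg.2 hst)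
    exact max_le (by linarith) (by linarith)
  set ε : ℝ := 1 / (1 + M) with hε
  have hε0 : 0 < ε := by positivity
  have hεM : 1 / ε = 1 + M := by rw [hε, one_div_one_div]
  set s : ℕ → ℝ := fun n => z - n * T with hs
  set η : ℕ → ℝ := fun n => 1 / ((n : ℝ) + 1) with hη
  have hη0 : ∀ n, 0 < η n := fun n => by positivity
  have hηlim : Tendsto η atTop (𝓝 0) := tendsto_one_div_add_atTop_nhds_zero_nat
  have hηanti : ∀ n, η (n + 1) ≤ η n := fun n => by
    simp only [hη]; push_cast; gcongr; linarith
  have hsB : ∀ n, B (s n) = 0 := fun n => by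
    simp only [hBdef, hs, hper.sub_nat_mul_eq, hz, max_self]
  have hsanti : ∀ n, s (n + 1) ≤ s n := fun n => by
    simp only [hs]; push_cast; nlinarith
  have hsanti' : Antitone s := antitone_nat_of_succ_le hsanti
  have hsev : ∀ t, ∃ N, s N ≤ t := fun t => by
    obtain ⟨N, hN⟩ := exists_nat_ge ((z - t) / T)
    rw [div_le_iff₀ hT] at hN
    exact ⟨N, by simp only [hs]; linarith⟩
  have hsev' : ∀ t, ∀ᶠ n in atTop, s n ≤ t := fun t => by
    obtain ⟨N, hN⟩ := hsev t
    filter_upwards [eventually_ge_atTop N] with n hn using (hsanti' hn).trans hN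
  choose X hXs hX using fun n =>
    exists_regularized_solution hBc hB0 hBM hdown hup (hη0 n) (hsB n)
  have hX0 : ∀ n t, s n ≤ t → 0 < X n t := fun n t h =>
    lt_of_lt_of_le (mul_pos hε0 (by linarith [hB0 t, hη0 n])) (hX n t h).1
  have hXcont : ∀ n a b, s n ≤ a → ContinuousOn (X n) (Icc a b) := fun n a b h t ht =>
    (hX n t (h.trans ht.1)).2.2.continuousAt.continuousWithinAt
  have hXanti : ∀ n t, s n ≤ t → X (n + 1) t ≤ X n t := by
    intro n t hst
    have := nonneg_of_deriv_barrier (f := fun t => X n t - X (n + 1) t) hst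
      ((hXcont n _ _ le_rfl).sub (hXcont (n + 1) _ _ (hsanti n))) ?_ ?_
    · linarith
    · have := (hX (n + 1) (s n) (hsanti n)).2.1
      rw [hsB] at this
      rw [hXs]
      linarith [hηanti n]
    · intro r hr hneg
      have h1 : s n ≤ r := hr.1.le
      have h2 := (hsanti n).trans h1
      refine ⟨_, (hX n r h1).2.2.sub (hX (n + 1) r h2).2.2, ?_⟩
      have : (B r + η (n + 1)) / X (n + 1) r ≤ (B r + η n) / X n r :=
        div_le_div₀ (by linarith [hB0 r, hη0 n]) (by linarith [hηanti n]) (hX0 n r h1)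
          (by linarith)
      linarith
  have hlim : ∀ t, ∃ l, Tendsto (fun n => X n t) atTop (𝓝 l) := by
    intro t
    obtain ⟨N, hN⟩ := hsev t
    have hst : ∀ k, s (k + N) ≤ t := fun k => (hsanti' (Nat.le_add_left N k)).trans hN
    have hanti : Antitone fun k => X (k + N) t := antitone_nat_of_succ_le fun k => by
      have := hXanti (k + N) t (hst k)
      rwa [show k + N + 1 = k + 1 + N by ring] at this
    have hbdd : BddBelow (range fun k => X (k + N) t) :=
      ⟨0, by rintro _ ⟨k, rfl⟩; exact (hX0 _ t (hst k)).le⟩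
    exact ⟨_, (tendsto_add_atTop_iff_nat N).1 (tendsto_atTop_ciInf hanti hbdd)⟩
  choose Y hY using hlim
  have hlow : ∀ t, ε * B t ≤ Y t := fun t => by
    refine ge_of_tendsto (hY t) ?_
    filter_upwards [hsev' t] with n hn
    refine le_trans ?_ (hX n t hn).1
    exact mul_le_mul_of_nonneg_left (by linarith [hη0 n]) hε0.le
  have hupp : ∀ t, Y t ≤ 2 * B t := fun t => by
    have h : Tendsto (fun n => 2 * (B t + η n)) atTop (𝓝 (2 * (B t + 0))) :=
      (hηlim.const_add _).const_mul _
    rw [add_zero] at h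
    refine le_of_tendsto_of_tendsto (hY t) h ?_
    filter_upwards [hsev' t] with n hn using (hX n t hn).2.1
  have hratio : ∀ n t, s n ≤ t → 0 ≤ (B t + η n) / X n t ∧ (B t + η n) / X n t ≤ 1 + M := by
    intro n t h
    have h1 : 0 < B t + η n := by linarith [hB0 t, hη0 n]
    refine ⟨(div_pos h1 (hX0 n t h)).le, ?_⟩
    rw [div_le_iff₀ (hX0 n t h), ← hεM, one_div, ← div_eq_inv_mul, le_div_iff₀ hε0, mul_comm]
    exact (hX n t h).1
  have hXlip : ∀ n p q, s n ≤ p → p ≤ q → |X n q - X n p| ≤ (1 + M) * (q - p) := by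
    intro n p q hp hpq
    have h1 := le_of_hasDerivAt_nonneg (f := fun t => X n t + 1 * t)
      (f' := fun t => -1 + (B t + η n) / X n t + 1 * 1) hpq
      ((hXcont n p q hp).add (by fun_prop))
      (fun r hr => (hX n r (hp.trans hr.1.le)).2.2.add ((hasDerivAt_id r).const_mul _))
      (fun r hr => by linarith [(hratio n r (hp.trans hr.1.le)).1])
    have h2 := le_of_hasDerivAt_nonneg (f := fun t => M * t - X n t)
      (f' := fun t => M * 1 - (-1 + (B t + η n) / X n t)) hpq
      (ContinuousOn.sub (by fun_prop) (hXcont n p q hp))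
      (fun r hr => ((hasDerivAt_id r).const_mul _).sub (hX n r (hp.trans hr.1.le)).2.2)
      (fun r hr => by linarith [(hratio n r (hp.trans hr.1.le)).2])
    have h3 := mul_nonneg hM0 (sub_nonneg.2 hpq)
    exact abs_le.2 ⟨by linarith, by linarith⟩
  have hYlip : ∀ p q, p ≤ q → |Y q - Y p| ≤ (1 + M) * (q - p) := by
    intro p q hpq
    refine le_of_tendsto ((hY q).sub (hY p)).abs ?_
    filter_upwards [hsev' p] with n hn using hXlip n p q hn hpq
  have hYc : Continuous Y := by
    refine (LipschitzWith.of_dist_le_mul (K := NNReal.mk (1 + M) (by positivity))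
      fun p q => ?_).continuous
    rw [NNReal.coe_mk, Real.dist_eq, Real.dist_eq]
    rcases le_total p q with h | h
    · rw [abs_sub_comm, abs_sub_comm p q, abs_of_nonneg (sub_nonneg.2 h)]
      exact hYlip p q h
    · rw [abs_of_nonneg (sub_nonneg.2 h)]
      exact hYlip q p h
  -- Near a point with `A > 0` the integrands are uniformly bounded, by `hratio`, so the integral
  -- equation passes to the limit by dominated convergence.
  refine ⟨Y, ε, hε0, hYc, hlow, hupp, fun t ht => ?_⟩
  obtain ⟨p, q, ⟨hpt, htq⟩, hpq⟩ : ∃ p q, t ∈ Ioo p q ∧ Icc p q ⊆ {r | 0 < A r} := by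
    obtain ⟨δ, hδ, hball⟩ := Metric.mem_nhds_iff.1
      ((isOpen_lt continuous_const hAc).mem_nhds (show t ∈ {r | 0 < A r} from ht))
    refine ⟨t - δ / 2, t + δ / 2, by constructor <;> linarith, fun r hr => hball ?_⟩
    rw [Real.ball_eq_Ioo]
    constructor <;> linarith [hr.1, hr.2]
  have hBA : ∀ r ∈ Icc p q, B r = A r := fun r hr => max_eq_left (hpq hr).le
  have hY0 : ∀ r ∈ Icc p q, 0 < Y r := fun r hr =>
    lt_of_lt_of_le (mul_pos hε0 (by rw [hBA r hr]; exact hpq hr)) (hlow r)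
  have hgc : ContinuousOn (fun r => -1 + B r / Y r) (Icc p q) :=
    continuousOn_const.add (hBc.continuousOn.div hYc.continuousOn fun r hr => (hY0 r hr).ne')
  have hint : ∀ r ∈ Icc p q, Y r = Y p + ∫ u in p..r, (-1 + B u / Y u) := by
    intro r hr
    have hsub : Icc p r ⊆ Icc p q := Icc_subset_Icc_right hr.2
    have hcn : ∀ᶠ n in atTop, ContinuousOn (fun u => -1 + (B u + η n) / X n u) (Icc p r) := by
      filter_upwards [hsev' p] with n hn
      exact continuousOn_const.add ((hBc.add continuous_const).continuousOn.div
        (hXcont n p r hn) fun u hu => (hX0 n u (hn.trans hu.1)).ne')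
    have h1 : Tendsto (fun n => ∫ u in p..r, (-1 + (B u + η n) / X n u)) atTop
        (𝓝 (∫ u in p..r, (-1 + B u / Y u))) := by
      refine intervalIntegral.tendsto_integral_filter_of_dominated_convergence
        (fun _ => 2 + M) ?_ ?_ ?_ ?_
      · filter_upwards [hcn] with n hn
        rw [uIoc_of_le hr.1]
        exact (hn.mono Ioc_subset_Icc_self).aestronglyMeasurable measurableSet_Ioc
      · filter_upwards [hsev' p] with n hn
        refine Eventually.of_forall fun u hu => ?_
        rw [uIoc_of_le hr.1] at hu
        have := hratio n u (hn.trans hu.1.le)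
        rw [Real.norm_eq_abs, abs_le]
        constructor <;> linarith
      · exact intervalIntegrable_const
      · refine Eventually.of_forall fun u hu => ?_
        rw [uIoc_of_le hr.1] at hu
        have h := ((hηlim.const_add (B u)).div (hY u)
          (hY0 u (hsub (Ioc_subset_Icc_self hu))).ne').const_add (-1)
        rwa [add_zero] at h
    have h2 : ∀ᶠ n in atTop, ∫ u in p..r, (-1 + (B u + η n) / X n u) = X n r - X n p := by
      filter_upwards [hcn, hsev' p] with n hn hsn
      refine intervalIntegral.integral_eq_sub_of_hasDerivAt (fun u hu => ?_) ?_
      · rw [uIcc_of_le hr.1] at hu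
        exact (hX n u (hsn.trans hu.1)).2.2
      · exact ContinuousOn.intervalIntegrable (by rwa [uIcc_of_le hr.1])
    have := tendsto_nhds_unique (h1.congr' h2) ((hY r).sub (hY p))
    linarith
  have htm : t ∈ Icc p q := ⟨hpt.le, htq.le⟩
  have hder : HasDerivAt (fun r => Y p + ∫ u in p..r, (-1 + B u / Y u)) (-1 + B t / Y t) t := by
    refine (intervalIntegral.integral_hasDerivAt_right ?_ ?_ ?_).const_add _
    · refine ContinuousOn.intervalIntegrable ?_
      rw [uIcc_of_le hpt.le]
      exact hgc.mono (Icc_subset_Icc_right htq.le)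
    · have hm : Measurable fun r => -1 + B r / Y r :=
        (hBc.measurable.div hYc.measurable).const_add _
      exact hm.stronglyMeasurable.stronglyMeasurableAtFilter
    · exact hgc.continuousAt (Icc_mem_nhds hpt htq)
  rw [show A t / Y t - 1 = -1 + B t / Y t by rw [hBA t htm]; ring]
  refine hder.congr_of_eventuallyEq ?_
  filter_upwards [Icc_mem_nhds hpt htq] with r hr using hint r hr

/-! ### Behaviour of the branch at the zeros of `A` -/

/-- The limit of `-x / A` at a zero of `A` with derivative `α`, for a solution `x` with the sign of
`-A`: the smaller positive root of `α u² + u = 1`, written so as to make sense for `α = 0`. -/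
noncomputable def limitRatio (α : ℝ) : ℝ := 2 / (1 + √(1 + 4 * α))

theorem limitRatio_spec {α : ℝ} (hα : -(1 / 4) < α) :
    0 < limitRatio α ∧ limitRatio α < 2 ∧ limitRatio α + α * limitRatio α ^ 2 = 1 := by
  have h0 : 0 < √(1 + 4 * α) := Real.sqrt_pos.2 (by linarith)
  have h1 := Real.sq_sqrt (show 0 ≤ 1 + 4 * α by linarith)
  set r := √(1 + 4 * α)
  have hα' : α = (r ^ 2 - 1) / 4 := by linarith
  refine ⟨by unfold limitRatio; positivity, ?_, ?_⟩
  · rw [limitRatio, div_lt_iff₀ (by positivity)]; linarith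
  · change 2 / (1 + r) + α * (2 / (1 + r)) ^ 2 = 1
    rw [hα']
    field_simp
    ring

theorem continuousAt_limitRatio {α : ℝ} : ContinuousAt limitRatio α :=
  continuousAt_const.div (by fun_prop)
    (by have := Real.sqrt_nonneg (1 + 4 * α); positivity)

theorem quadratic_mono {m p q : ℝ} (hm : -(1 / 4) < m) (hp : 0 ≤ p) (hpq : p ≤ q) (hq : q ≤ 2) :
    p + m * p ^ 2 ≤ q + m * q ^ 2 := by
  have : 0 ≤ 1 + m * (p + q) := by nlinarith
  nlinarith [mul_nonneg (sub_nonneg.2 hpq) this]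

theorem quadratic_strictMono {m p q : ℝ} (hm : -(1 / 4) < m) (hp : 0 ≤ p) (hpq : p < q)
    (hq : q ≤ 2) : p + m * p ^ 2 < q + m * q ^ 2 := by
  have : 0 < 1 + m * (p + q) := by nlinarith
  nlinarith [mul_pos (sub_pos.2 hpq) this]

section

variable {A X : ℝ → ℝ} {ε t₀ : ℝ}

theorem IsPositiveBranch.pos (hX : IsPositiveBranch A X ε) (hε : 0 < ε) {t : ℝ} (ht : 0 < A t) :
    0 < X t :=
  lt_of_lt_of_le (mul_pos hε (lt_max_of_lt_left ht)) (hX.lower t)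

theorem IsPositiveBranch.nonneg (hX : IsPositiveBranch A X ε) (hε : 0 < ε) (t : ℝ) : 0 ≤ X t :=
  (mul_nonneg hε.le (le_max_right _ _)).trans (hX.lower t)

theorem IsPositiveBranch.eq_zero (hX : IsPositiveBranch A X ε) (hε : 0 < ε) {t : ℝ} (ht : A t ≤ 0) :
    X t = 0 := by
  have := hX.upper t
  rw [max_eq_right ht] at this
  linarith [hX.nonneg hε t]

theorem hasDerivAt_max_zero (hA : ContDiff ℝ 1 A) {t : ℝ} (ht : 0 < A t) :
    HasDerivAt (fun r => max (A r) 0) (deriv A t) t := by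
  refine (hA.differentiable one_ne_zero t).hasDerivAt.congr_of_eventuallyEq ?_
  filter_upwards [continuous_const.continuousAt.eventually_lt hA.continuous.continuousAt ht]
    with r hr using max_eq_left hr.le

theorem exists_forall_Ioo_of_eventually {P : ℝ → Prop} (h : ∀ᶠ t in 𝓝 t₀, P t) :
    ∃ δ > 0, ∀ t ∈ Ioo (t₀ - δ) (t₀ + δ), P t := by
  obtain ⟨δ, hδ, h⟩ := Metric.eventually_nhds_iff_ball.1 h
  exact ⟨δ, hδ, fun t ht => h t (by rwa [Real.ball_eq_Ioo])⟩

/-- The barrier `K A` cannot be crossed upwards near `t₀`. The branch cannot stay above it all the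
way up to `t₀` either: if `p` is the infimum of `X / A` there, integrating `Ẋ` and `Ȧ` back from
`t₀` gives `p + m p² ≤ 1`, where `m` is a lower bound of `Ȧ` so close to `Ȧ(t₀)` that this
contradicts `K ≤ p`. -/
theorem IsPositiveBranch.eventually_le (hX : IsPositiveBranch A X ε) (hε : 0 < ε)
    (hA : ContDiff ℝ 1 A) (h0 : A t₀ = 0) (hα : -(1 / 4) < deriv A t₀) {K : ℝ} (hK0 : 0 < K)
    (hK : 1 < K + deriv A t₀ * K ^ 2) :
    ∀ᶠ t in 𝓝 t₀, X t ≤ K * max (A t) 0 := by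
  obtain ⟨m, hm, hmα⟩ := exists_between (max_lt hα
    (show (1 - K) / K ^ 2 < deriv A t₀ by rw [div_lt_iff₀ (by positivity)]; linarith))
  obtain ⟨hm4, hmK⟩ := max_lt_iff.1 hm
  rw [div_lt_iff₀ (by positivity)] at hmK
  have hXc := hX.continuous
  have hAc := hA.continuous
  obtain ⟨δ, hδ, hAm⟩ := exists_forall_Ioo_of_eventually
    (continuous_const.continuousAt.eventually_lt (hA.continuous_deriv le_rfl).continuousAt hmα)
  have hneg : ∀ r, K * max (A r) 0 - X r < 0 → 0 < A r ∧ K * A r < X r := by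
    intro r hr
    rcases le_or_gt (A r) 0 with h | h
    · rw [max_eq_right h, hX.eq_zero hε h] at hr
      simp at hr
    · rw [max_eq_left h.le] at hr
      exact ⟨h, by linarith⟩
  have hpers : ∀ s t, t₀ - δ < s → s ≤ t → t < t₀ + δ → 0 ≤ K * max (A s) 0 - X s →
      0 ≤ K * max (A t) 0 - X t := by
    intro s t hs hst ht hfs
    refine nonneg_of_deriv_barrier (f := fun r => K * max (A r) 0 - X r) hst (by fun_prop) hfs
      fun r hr hr0 => ?_
    obtain ⟨hAr, hXr⟩ := hneg r hr0
    refine ⟨_, ((hasDerivAt_max_zero hA hAr).const_mul K).sub (hX.hasDerivAt r hAr), ?_⟩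
    have h1 : A r / X r ≤ 1 / K := by
      rw [div_le_div_iff₀ (hX.pos hε hAr) hK0]; linarith
    have h2 : K * m ≤ K * deriv A r :=
      mul_le_mul_of_nonneg_left (hAm r ⟨by linarith [hr.1], by linarith [hr.2]⟩).le hK0.le
    have h3 : 1 / K < 1 + K * m := by
      rw [div_lt_iff₀ hK0]; nlinarith
    linarith
  by_cases hex : ∃ s ∈ Ioo (t₀ - δ) t₀, 0 ≤ K * max (A s) 0 - X s
  · obtain ⟨s, hs, hfs⟩ := hex
    filter_upwards [Ioo_mem_nhds hs.2 (show t₀ < t₀ + δ by linarith)] with t ht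
    linarith [hpers s t hs.1 ht.1.le ht.2 hfs]
  exfalso
  push Not at hex
  have hall : ∀ s ∈ Ioo (t₀ - δ) t₀, 0 < A s ∧ K * A s < X s := fun s hs => hneg s (hex s hs)
  set U : Set ℝ := (fun s => X s / A s) '' Ioo (t₀ - δ) t₀ with hU
  have hUne : U.Nonempty := (nonempty_Ioo.2 (by linarith)).image _
  have hUK : ∀ u ∈ U, K ≤ u := by
    rintro _ ⟨s, hs, rfl⟩
    exact (le_div_iff₀ (hall s hs).1).2 (hall s hs).2.le
  have hbdd : BddBelow U := ⟨K, hUK⟩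
  set p := sInf U with hp
  have hKp : K ≤ p := le_csInf hUne hUK
  have hp0 : 0 < p := hK0.trans_le hKp
  have hp2 : p ≤ 2 := by
    obtain ⟨u, hu⟩ := hUne
    refine (csInf_le hbdd hu).trans ?_
    obtain ⟨s, hs, rfl⟩ := hu
    have := hX.upper s
    rw [max_eq_left (hall s hs).1.le] at this
    exact (div_le_iff₀ (hall s hs).1).2 this
  have hest : ∀ s ∈ Ioo (t₀ - δ) t₀, (1 - 1 / p) * (t₀ - s) ≤ X s ∧ A s ≤ -m * (t₀ - s) := by
    intro s hs
    have h1 := le_of_hasDerivAt_nonneg (f := fun r => -(1 - 1 / p) * r - X r)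
      (f' := fun r => -(1 - 1 / p) * 1 - (A r / X r - 1)) hs.2.le (by fun_prop)
      (fun r hr => ((hasDerivAt_id r).const_mul _).sub
        (hX.hasDerivAt r (hall r ⟨hs.1.trans hr.1, hr.2⟩).1)) (fun r hr => ?_)
    · have h2 := le_of_hasDerivAt_nonneg (f := fun r => A r - m * r)
        (f' := fun r => deriv A r - m * 1) hs.2.le (by fun_prop)
        (fun r _ => (hA.differentiable one_ne_zero r).hasDerivAt.sub
          ((hasDerivAt_id r).const_mul _))
        (fun r hr => by
          linarith [hAm r ⟨hs.1.trans hr.1, by linarith [hr.2]⟩])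
      have h3 := hX.eq_zero hε h0.le
      constructor <;> linarith
    · have hr' : r ∈ Ioo (t₀ - δ) t₀ := ⟨hs.1.trans hr.1, hr.2⟩
      have hAr := (hall r hr').1
      have h3 : p ≤ X r / A r := csInf_le hbdd ⟨r, hr', rfl⟩
      have h4 : A r / X r ≤ 1 / p := by
        rw [le_div_iff₀ hAr] at h3
        rw [div_le_div_iff₀ (hX.pos hε hAr) hp0]; linarith
      linarith
  obtain ⟨s₀, hs₀⟩ : (Ioo (t₀ - δ) t₀).Nonempty := nonempty_Ioo.2 (by linarith)
  have hm0 : m < 0 := by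
    have h1 := (hest s₀ hs₀).2
    have h2 := (hall s₀ hs₀).1
    by_contra! h
    nlinarith [mul_nonneg h (sub_pos.2 hs₀.2).le]
  have hpm : (1 - 1 / p) / -m ≤ p := by
    refine le_csInf hUne ?_
    rintro _ ⟨s, hs, rfl⟩
    obtain ⟨h1, h2⟩ := hest s hs
    have hAs := (hall s hs).1
    have hXA : X s = X s / A s * A s := by field_simp
    have hu : 0 < X s / A s := div_pos (hX.pos hε hAs) hAs
    have h3 : X s / A s * A s ≤ X s / A s * (-m * (t₀ - s)) := mul_le_mul_of_nonneg_left h2 hu.le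
    change (1 - 1 / p) / -m ≤ X s / A s
    rw [div_le_iff₀ (by linarith)]
    exact le_of_mul_le_mul_right (by linarith : _ ≤ (X s / A s * -m) * (t₀ - s))
      (sub_pos.2 hs.2)
  rw [div_le_iff₀ (by linarith)] at hpm
  have h5 : p * (1 - 1 / p) ≤ p * (p * -m) := mul_le_mul_of_nonneg_left hpm hp0.le
  have h6 : p * (1 - 1 / p) = p - 1 := by field_simp
  have := quadratic_mono hm4 hK0.le hKp hp2
  nlinarith

/-- The mirror image of the upper estimate: `k A` is a barrier from below, and the supremum `P` of
`X / A` would satisfy `1 ≤ P + M P²` for an upper bound `M` of `Ȧ` near `t₀`, contrary to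
`P ≤ k`. -/
theorem IsPositiveBranch.eventually_ge (hX : IsPositiveBranch A X ε) (hε : 0 < ε)
    (hA : ContDiff ℝ 1 A) (h0 : A t₀ = 0) (hα : -(1 / 4) < deriv A t₀) {k : ℝ} (hk0 : 0 < k)
    (hk2 : k ≤ 2) (hk : k + deriv A t₀ * k ^ 2 < 1) :
    ∀ᶠ t in 𝓝 t₀, k * max (A t) 0 ≤ X t := by
  obtain ⟨M, hMα, hMk⟩ := exists_between
    (show deriv A t₀ < (1 - k) / k ^ 2 by rw [lt_div_iff₀ (by positivity)]; linarith)
  have hM4 : -(1 / 4) < M := hα.trans hMα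
  rw [lt_div_iff₀ (by positivity)] at hMk
  have hXc := hX.continuous
  have hAc := hA.continuous
  obtain ⟨δ, hδ, hAM⟩ := exists_forall_Ioo_of_eventually
    ((hA.continuous_deriv le_rfl).continuousAt.eventually_lt continuous_const.continuousAt hMα)
  have hneg : ∀ r, X r - k * max (A r) 0 < 0 → 0 < A r ∧ X r < k * A r := by
    intro r hr
    rcases le_or_gt (A r) 0 with h | h
    · rw [max_eq_right h, hX.eq_zero hε h] at hr
      simp at hr
    · rw [max_eq_left h.le] at hr
      exact ⟨h, by linarith⟩
  have hpers : ∀ s t, t₀ - δ < s → s ≤ t → t < t₀ + δ → 0 ≤ X s - k * max (A s) 0 →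
      0 ≤ X t - k * max (A t) 0 := by
    intro s t hs hst ht hfs
    refine nonneg_of_deriv_barrier (f := fun r => X r - k * max (A r) 0) hst (by fun_prop) hfs
      fun r hr hr0 => ?_
    obtain ⟨hAr, hXr⟩ := hneg r hr0
    refine ⟨_, (hX.hasDerivAt r hAr).sub ((hasDerivAt_max_zero hA hAr).const_mul k), ?_⟩
    have h1 : 1 / k ≤ A r / X r := by
      rw [div_le_div_iff₀ hk0 (hX.pos hε hAr)]; linarith
    have h2 : k * deriv A r ≤ k * M :=
      mul_le_mul_of_nonneg_left (hAM r ⟨by linarith [hr.1], by linarith [hr.2]⟩).le hk0.le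
    have h3 : 1 + k * M < 1 / k := by
      rw [lt_div_iff₀ hk0]; nlinarith
    linarith
  by_cases hex : ∃ s ∈ Ioo (t₀ - δ) t₀, 0 ≤ X s - k * max (A s) 0
  · obtain ⟨s, hs, hfs⟩ := hex
    filter_upwards [Ioo_mem_nhds hs.2 (show t₀ < t₀ + δ by linarith)] with t ht
    linarith [hpers s t hs.1 ht.1.le ht.2 hfs]
  exfalso
  push Not at hex
  have hall : ∀ s ∈ Ioo (t₀ - δ) t₀, 0 < A s ∧ X s < k * A s := fun s hs => hneg s (hex s hs)
  set U : Set ℝ := (fun s => X s / A s) '' Ioo (t₀ - δ) t₀ with hU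
  obtain ⟨s₀, hs₀⟩ : (Ioo (t₀ - δ) t₀).Nonempty := nonempty_Ioo.2 (by linarith)
  have hUne : U.Nonempty := ⟨_, s₀, hs₀, rfl⟩
  have hUk : ∀ u ∈ U, u ≤ k := by
    rintro _ ⟨s, hs, rfl⟩
    exact (div_le_iff₀ (hall s hs).1).2 (hall s hs).2.le
  have hbdd : BddAbove U := ⟨k, hUk⟩
  set P := sSup U with hP
  have hPk : P ≤ k := csSup_le hUne hUk
  have hP0 : 0 < P := lt_of_lt_of_le
    (div_pos (hX.pos hε (hall s₀ hs₀).1) (hall s₀ hs₀).1) (le_csSup hbdd ⟨s₀, hs₀, rfl⟩)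
  have hest : ∀ s ∈ Ioo (t₀ - δ) t₀, X s ≤ (1 - 1 / P) * (t₀ - s) ∧ -M * (t₀ - s) ≤ A s := by
    intro s hs
    have h1 := le_of_hasDerivAt_nonneg (f := fun r => X r - -(1 - 1 / P) * r)
      (f' := fun r => (A r / X r - 1) - -(1 - 1 / P) * 1) hs.2.le (by fun_prop)
      (fun r hr => (hX.hasDerivAt r (hall r ⟨hs.1.trans hr.1, hr.2⟩).1).sub
        ((hasDerivAt_id r).const_mul _)) (fun r hr => ?_)
    · have h2 := le_of_hasDerivAt_nonneg (f := fun r => M * r - A r)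
        (f' := fun r => M * 1 - deriv A r) hs.2.le (by fun_prop)
        (fun r _ => ((hasDerivAt_id r).const_mul _).sub
          (hA.differentiable one_ne_zero r).hasDerivAt)
        (fun r hr => by
          linarith [hAM r ⟨hs.1.trans hr.1, by linarith [hr.2]⟩])
      have h3 := hX.eq_zero hε h0.le
      constructor <;> linarith
    · have hr' : r ∈ Ioo (t₀ - δ) t₀ := ⟨hs.1.trans hr.1, hr.2⟩
      have hAr := (hall r hr').1
      have h3 : X r / A r ≤ P := le_csSup hbdd ⟨r, hr', rfl⟩
      have h4 : 1 / P ≤ A r / X r := by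
        rw [div_le_iff₀ hAr] at h3
        rw [div_le_div_iff₀ hP0 (hX.pos hε hAr)]; linarith
      linarith
  have h6 : P * (1 - 1 / P) = P - 1 := by field_simp
  rcases lt_or_ge M 0 with hM0 | hM0
  · have hPM : P ≤ (1 - 1 / P) / -M := by
      refine csSup_le hUne ?_
      rintro _ ⟨s, hs, rfl⟩
      obtain ⟨h1, h2⟩ := hest s hs
      have hAs := (hall s hs).1
      have hXA : X s = X s / A s * A s := by field_simp
      have hu : 0 < X s / A s := div_pos (hX.pos hε hAs) hAs
      have h3 : X s / A s * (-M * (t₀ - s)) ≤ X s / A s * A s := mul_le_mul_of_nonneg_left h2 hu.le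
      change X s / A s ≤ (1 - 1 / P) / -M
      rw [le_div_iff₀ (by linarith)]
      exact le_of_mul_le_mul_right (by linarith : (X s / A s * -M) * (t₀ - s) ≤ _)
        (sub_pos.2 hs.2)
    rw [le_div_iff₀ (by linarith)] at hPM
    have h5 : P * (P * -M) ≤ P * (1 - 1 / P) := mul_le_mul_of_nonneg_left hPM hP0.le
    have := quadratic_mono hM4 hP0.le hPk hk2
    nlinarith
  · -- Here `k < 1`, so `X` would be increasing towards its zero `t₀`.
    have h1 := (hX.pos hε (hall s₀ hs₀).1).trans_le (hest s₀ hs₀).1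
    have h2 : 0 < 1 - 1 / P := pos_of_mul_pos_left h1 (sub_pos.2 hs₀.2).le
    have h3 := mul_pos hP0 h2
    nlinarith [mul_nonneg hM0 (sq_nonneg k)]

theorem IsPositiveBranch.eventually_abs_sub_le (hX : IsPositiveBranch A X ε) (hε : 0 < ε)
    (hA : ContDiff ℝ 1 A) (h0 : A t₀ = 0) (hα : -(1 / 4) < deriv A t₀) {η : ℝ} (hη : 0 < η) :
    ∀ᶠ t in 𝓝 t₀, |X t - limitRatio (deriv A t₀) * max (A t) 0| ≤ η * max (A t) 0 := by
  obtain ⟨hu0, hu2, hu⟩ := limitRatio_spec hα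
  set u := limitRatio (deriv A t₀)
  have hK : u < min (u + η) 2 := lt_min (by linarith) hu2
  have hk : max (u - η) (u / 2) < u := max_lt (by linarith) (by linarith)
  have hk0 : 0 < max (u - η) (u / 2) := lt_max_of_lt_right (by linarith)
  have h1 := quadratic_strictMono hα hu0.le hK (min_le_right _ _)
  have h2 := quadratic_strictMono hα hk0.le hk hu2.le
  filter_upwards [hX.eventually_le hε hA h0 hα (hu0.trans hK) (by linarith),
    hX.eventually_ge hε hA h0 hα hk0 (by linarith) (by linarith)] with t ht1 ht2
  have hB : 0 ≤ max (A t) 0 := le_max_right _ _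
  have h3 := mul_le_mul_of_nonneg_right (min_le_left (u + η) 2) hB
  have h4 := mul_le_mul_of_nonneg_right (le_max_left (u - η) (u / 2)) hB
  exact abs_le.2 ⟨by linarith, by linarith⟩

end

/-! ### The solution with the sign of `-A` -/

theorem deriv_neg_comp_neg (A : ℝ → ℝ) (t : ℝ) : deriv (fun s => -A (-s)) t = deriv A (-t) := by
  rw [deriv.fun_neg, deriv_comp_neg, neg_neg]

/-- The derivative is read off from `ẋ = 1 - 1 / U`, where `U = -x / A` extends continuously to the
zeros of `A`, with the value `limitRatio` there. -/
theorem exists_solution_sign_neg {A : ℝ → ℝ} {T z : ℝ} (hT : 0 < T) (hA : ContDiff ℝ 1 A)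
    (hper : Function.Periodic A T) (hz : A z = 0) (hmin : ∀ t, -(1 / 4 : ℝ) < deriv A t) :
    ∃ x : ℝ → ℝ, IsAbelSolution A x ∧ ContDiff ℝ 1 x ∧
      ∀ t, SignType.sign (x t) = SignType.sign (-(A t)) := by
  obtain ⟨X, ε, hε, hX⟩ := exists_isPositiveBranch hT hA hper hz hmin
  have hA' : ContDiff ℝ 1 fun t => -A (-t) := (hA.comp contDiff_neg).neg
  obtain ⟨Y, ε', hε', hY⟩ := exists_isPositiveBranch (z := -z) hT hA'
    (fun t => by rw [neg_add', hper.sub_eq]) (by rw [neg_neg, hz, neg_zero])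
    (fun t => by rw [deriv_neg_comp_neg]; exact hmin _)
  have hAc := hA.continuous
  have hAd : ∀ t, HasDerivAt A (deriv A t) t := fun t =>
    (hA.differentiable one_ne_zero t).hasDerivAt
  set x : ℝ → ℝ := fun t => Y (-t) - X t with hx
  have hpos : ∀ t, 0 < A t → x t = -X t := fun t ht => by
    rw [hx]; simp only
    rw [hY.eq_zero hε' (by rw [neg_neg]; linarith), zero_sub]
  have hneg : ∀ t, A t < 0 → x t = Y (-t) := fun t ht => by
    rw [hx]; simp only
    rw [hX.eq_zero hε ht.le, sub_zero]
  have hzero : ∀ t, A t = 0 → x t = 0 := fun t ht => by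
    rw [hx]; simp only
    rw [hX.eq_zero hε ht.le, hY.eq_zero hε' (by rw [neg_neg, ht, neg_zero]), sub_zero]
  have hxneg : ∀ t, 0 < A t → x t < 0 := fun t ht => by
    rw [hpos t ht]; linarith [hX.pos hε ht]
  have hxpos : ∀ t, A t < 0 → 0 < x t := fun t ht => by
    rw [hneg t ht]; exact hY.pos hε' (by rw [neg_neg]; linarith)
  have hxne : ∀ t, A t ≠ 0 → x t ≠ 0 := fun t ht =>
    ht.lt_or_gt.elim (fun h => (hxpos t h).ne') fun h => (hxneg t h).ne
  have hder : ∀ t, A t ≠ 0 → HasDerivAt x (1 + A t / x t) t := by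
    intro t ht
    rcases ht.lt_or_gt with h | h
    · have h1 : 0 < -A (- -t) := by rw [neg_neg]; linarith
      have h2 := (hY.hasDerivAt (-t) h1).comp t (hasDerivAt_neg t)
      rw [neg_neg, ← hneg t h] at h2
      rw [show 1 + A t / x t = (-A t / x t - 1) * -1 by ring]
      refine h2.congr_of_eventuallyEq ?_
      filter_upwards [hAc.continuousAt.eventually_lt continuous_const.continuousAt h] with r hr
        using hneg r hr
    · have h2 := (hX.hasDerivAt t h).neg
      rw [show 1 + A t / x t = -(A t / X t - 1) by rw [hpos t h, div_neg]; ring]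
      refine h2.congr_of_eventuallyEq ?_
      filter_upwards [continuous_const.continuousAt.eventually_lt hAc.continuousAt h] with r hr
        using hpos r hr
  have hnear : ∀ t₀, A t₀ = 0 → ∀ η > 0,
      ∀ᶠ t in 𝓝 t₀, |x t + limitRatio (deriv A t₀) * A t| ≤ η * |A t| := by
    intro t₀ h0 η hη
    have h1 := hX.eventually_abs_sub_le hε hA h0 (by linarith [hmin t₀]) hη
    have h2 := hY.eventually_abs_sub_le (t₀ := -t₀) hε' hA' (by rw [neg_neg, h0, neg_zero])
      (by rw [deriv_neg_comp_neg]; linarith [hmin (- -t₀)]) hη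
    rw [deriv_neg_comp_neg, neg_neg] at h2
    filter_upwards [h1, continuous_neg.continuousAt.eventually h2] with t ht1 ht2
    rw [neg_neg] at ht2
    rcases le_total (A t) 0 with h | h
    · rw [hX.eq_zero hε h, max_eq_right h] at ht1
      rw [max_eq_left (by linarith)] at ht2
      rw [abs_of_nonpos h, hx]
      simp only
      rwa [hX.eq_zero hε h, sub_zero, ← sub_neg_eq_add, ← mul_neg]
    · rw [max_eq_left h] at ht1
      rw [abs_of_nonneg h, hx]
      simp only
      rw [hY.eq_zero hε' (by rw [neg_neg]; linarith), abs_sub_comm] at *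
      rwa [zero_sub, neg_add_eq_sub]
  have hder0 : ∀ t₀, A t₀ = 0 →
      HasDerivAt x (-(limitRatio (deriv A t₀) * deriv A t₀)) t₀ := by
    intro t₀ h0
    have h1 : HasDerivAt (fun t => x t + limitRatio (deriv A t₀) * A t) 0 t₀ := by
      rw [hasDerivAt_iff_isLittleO]
      have h2 : (fun t => x t + limitRatio (deriv A t₀) * A t) =o[𝓝 t₀] A :=
        Asymptotics.isLittleO_iff.2 fun η hη => hnear t₀ h0 η hη
      have h3 := (hAd t₀).isBigO_sub
      simp only [h0, sub_zero] at h3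
      simpa [h0, hzero t₀ h0] using h2.trans_isBigO h3
    have h4 := h1.sub ((hAd t₀).const_mul (limitRatio (deriv A t₀)))
    rw [zero_sub] at h4
    refine h4.congr_of_eventuallyEq (Eventually.of_forall fun t => ?_)
    simp
  -- At a zero, `1 - 1 / limitRatio α = -α * limitRatio α`, so one formula covers both cases.
  set U : ℝ → ℝ := fun t => if A t = 0 then limitRatio (deriv A t) else -x t / A t with hU
  have hspec := fun t => limitRatio_spec (α := deriv A t) (by linarith [hmin t])
  have hxd : ∀ t, HasDerivAt x (1 - 1 / U t) t := by
    intro t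
    by_cases h : A t = 0
    · have h1 := hder0 t h
      obtain ⟨hu0, -, hu⟩ := hspec t
      simp only [hU, if_pos h]
      rwa [show 1 - 1 / limitRatio (deriv A t) = -(limitRatio (deriv A t) * deriv A t) by
        field_simp; linarith]
    · have h1 := hder t h
      have h2 := hxne t h
      simp only [hU, if_neg h]
      rwa [show 1 - 1 / (-x t / A t) = 1 + A t / x t by field_simp; ring]
  have hxc : Continuous x := continuous_iff_continuousAt.2 fun t => (hxd t).continuousAt
  have hUne : ∀ t, U t ≠ 0 := by
    intro t
    by_cases h : A t = 0
    · simp only [hU, if_pos h]; exact (hspec t).1.ne'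
    · simp only [hU, if_neg h]; exact div_ne_zero (neg_ne_zero.2 (hxne t h)) h
  have hUc : Continuous U := by
    refine continuous_iff_continuousAt.2 fun t₀ => ?_
    by_cases h : A t₀ = 0
    · rw [Metric.continuousAt_iff']
      intro η hη
      have hlr : ContinuousAt (fun t => limitRatio (deriv A t)) t₀ :=
        continuousAt_limitRatio.comp_of_eq (hA.continuous_deriv le_rfl).continuousAt rfl
      filter_upwards [Metric.continuousAt_iff'.1 hlr η hη, hnear t₀ h (η / 2) (by linarith)]
        with t ht1 ht2
      simp only [hU, if_pos h]
      by_cases ht : A t = 0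
      · rwa [if_pos ht]
      · rw [if_neg ht, Real.dist_eq]
        have h1 : -x t / A t - limitRatio (deriv A t₀)
            = -(x t + limitRatio (deriv A t₀) * A t) / A t := by
          field_simp; ring
        rw [h1, abs_div, abs_neg]
        refine lt_of_le_of_lt ((div_le_iff₀ (abs_pos.2 ht)).2 ht2) (by linarith)
    · have h1 : ContinuousAt (fun t => -x t / A t) t₀ :=
        hxc.neg.continuousAt.div hAc.continuousAt h
      refine h1.congr ?_
      filter_upwards [hAc.continuousAt.eventually_ne h] with t ht
      simp only [hU, if_neg ht]
  have hxdiff : Differentiable ℝ x := fun t => (hxd t).differentiableAt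
  refine ⟨x, ⟨hxdiff, fun t => ?_⟩, ?_, fun t => ?_⟩
  · by_cases h : A t = 0
    · rw [h, hzero t h]; ring
    · have h2 := hxne t h
      rw [(hder t h).deriv]
      field_simp
      ring
  · rw [contDiff_one_iff_deriv]
    refine ⟨hxdiff, ?_⟩
    rw [show deriv x = fun t => 1 - 1 / U t from funext fun t => (hxd t).deriv]
    exact continuous_const.sub (continuous_const.div hUc hUne)
  · rcases lt_trichotomy (A t) 0 with h | h | h
    · rw [sign_pos (hxpos t h), sign_pos (by linarith)]
    · rw [hzero t h, h, neg_zero]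
    · rw [sign_neg (hxneg t h), sign_neg (by linarith)]

/-! ### Reflection, uniqueness and growth -/

theorem isAbelSolution_reflect {A x : ℝ → ℝ} (hx : IsAbelSolution A x) :
    IsAbelSolution (fun t => -A (-t)) (fun t => -x (-t)) := by
  refine ⟨(hx.1.comp differentiable_neg).neg, fun t => ?_⟩
  rw [deriv_neg_comp_neg]
  linarith [hx.2 (-t)]

theorem hasDerivAt_of_isAbelSolution {A x : ℝ → ℝ} (hx : IsAbelSolution A x) {t : ℝ}
    (ht : x t ≠ 0) :
    HasDerivAt x (1 + A t / x t) t := by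
  have h := hx.2 t
  have : deriv x t = 1 + A t / x t := by field_simp; linarith
  rw [← this]
  exact (hx.1 t).hasDerivAt

/-- Over an interval where `A` is positive, two negative solutions approach each other. As they
agree at its left end, where both vanish, they cannot differ. -/
theorem le_of_sign_neg_of_pos {A x y : ℝ → ℝ} {s t : ℝ} (hA : Continuous A)
    (hx : IsAbelSolution A x) (hy : IsAbelSolution A y)
    (hxs : ∀ t, SignType.sign (x t) = SignType.sign (-(A t)))
    (hys : ∀ t, SignType.sign (y t) = SignType.sign (-(A t)))
    (hs : A s = 0) (hst : s ≤ t) (ht : 0 < A t) : x t ≤ y t := by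
  have hK : IsCompact (Icc s t ∩ A ⁻¹' {0}) :=
    isCompact_Icc.inter_right (isClosed_singleton.preimage hA)
  obtain ⟨a, ⟨ha, hAa⟩, hmax⟩ := hK.exists_isGreatest ⟨s, ⟨le_rfl, hst⟩, hs⟩
  have hAa' : A a = 0 := hAa
  have hApos : ∀ r ∈ Ioo a t, 0 < A r := by
    intro r hr
    by_contra! hr0
    obtain ⟨c, hc, hAc⟩ := intermediate_value_Icc hr.2.le hA.continuousOn ⟨hr0, ht.le⟩
    have := hmax ⟨⟨ha.1.trans (hr.1.le.trans hc.1), hc.2⟩, hAc⟩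
    linarith [hr.1, hc.1]
  have hval : ∀ w : ℝ → ℝ, (∀ t, SignType.sign (w t) = SignType.sign (-(A t))) → w a = 0 := by
    intro w hw
    have := hw a
    rwa [hAa', neg_zero, sign_zero, sign_eq_zero_iff] at this
  have hnegv : ∀ w : ℝ → ℝ, (∀ t, SignType.sign (w t) = SignType.sign (-(A t))) →
      ∀ r, 0 < A r → w r < 0 := by
    intro w hw r hr
    have := hw r
    rwa [sign_neg (show -A r < 0 by linarith), sign_eq_neg_one_iff] at this
  have hxc := hx.1.continuous
  have hyc := hy.1.continuous
  have := nonneg_of_deriv_barrier (f := fun r => y r - x r) ha.2 (by fun_prop)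
    (by rw [hval x hxs, hval y hys, sub_zero]) fun r hr hr0 => ?_
  · linarith
  have hAr := hApos r hr
  have hxr := hnegv x hxs r hAr
  have hyr := hnegv y hys r hAr
  refine ⟨_, (hasDerivAt_of_isAbelSolution hy hyr.ne).sub
    (hasDerivAt_of_isAbelSolution hx hxr.ne), ?_⟩
  have : A r / -y r ≤ A r / -x r :=
    div_le_div_of_nonneg_left hAr.le (by linarith) (by linarith)
  rw [div_neg, div_neg] at this
  linarith

/-- Two solutions are compared forwards from an earlier zero of `A` where `A > 0`, and by reflection
backwards from a later one where `A < 0`. -/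
theorem eq_of_sign_neg {A x y : ℝ → ℝ} {T z : ℝ} (hT : 0 < T) (hA : Continuous A)
    (hper : Function.Periodic A T) (hz : A z = 0)
    (hx : IsAbelSolution A x) (hy : IsAbelSolution A y)
    (hxs : ∀ t, SignType.sign (x t) = SignType.sign (-(A t)))
    (hys : ∀ t, SignType.sign (y t) = SignType.sign (-(A t))) : x = y := by
  funext t
  obtain ⟨n, hn⟩ := exists_nat_ge (|t - z| / T)
  rw [div_le_iff₀ hT, abs_le] at hn
  rcases lt_trichotomy (A t) 0 with h | h | h
  · have hsign : ∀ w : ℝ → ℝ, (∀ t, SignType.sign (w t) = SignType.sign (-(A t))) →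
        ∀ t, SignType.sign (-w (-t)) = SignType.sign (-(-A (-t))) := fun w hw t => by
      rw [Left.sign_neg, Left.sign_neg (-A (-t)), hw]
    have hs : -A (- -(z + n * T)) = 0 := by rw [neg_neg, hper.nat_mul n z, hz, neg_zero]
    have hst : -(z + n * T) ≤ -t := by linarith
    have hpos : 0 < -A (- -t) := by rw [neg_neg]; linarith
    have hA' : Continuous fun t => -A (-t) := (hA.comp continuous_neg).neg
    have h1 := le_of_sign_neg_of_pos hA' (isAbelSolution_reflect hx) (isAbelSolution_reflect hy)
      (hsign x hxs) (hsign y hys) hs hst hpos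
    have h2 := le_of_sign_neg_of_pos hA' (isAbelSolution_reflect hy) (isAbelSolution_reflect hx)
      (hsign y hys) (hsign x hxs) hs hst hpos
    rw [neg_neg] at h1 h2
    linarith
  · have h1 := hxs t
    have h2 := hys t
    rw [h, neg_zero, sign_zero, sign_eq_zero_iff] at h1 h2
    rw [h1, h2]
  · have hs : A (z - n * T) = 0 := by rw [hper.sub_nat_mul_eq, hz]
    have hst : z - n * T ≤ t := by linarith
    exact le_antisymm (le_of_sign_neg_of_pos hA hx hy hxs hys hs hst h)
      (le_of_sign_neg_of_pos hA hy hx hys hxs hs hst h)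

/-- The region `x > 0`, `x + 2 A > 0` is never left: inside it `ẋ = 1 + A / x > 1 / 2`, so `x`
grows, and on its edge `x + 2 A = 0` the derivative of `x + 2 A` is `1 / 2 + 2 Ȧ > 0`. Cutting off
the denominator at a level `c` below the initial value does not affect this; `c = 0` is the
equation itself. -/
theorem add_half_le_of_pos {A x : ℝ → ℝ} {t₀ c : ℝ} (hA : ContDiff ℝ 1 A)
    (hmin : ∀ t, -(1 / 4 : ℝ) < deriv A t)
    (hx : ∀ t, t₀ ≤ t → 0 < x t → HasDerivAt x (1 + A t / max (x t) c) t)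
    (hxc : ContinuousOn x (Ici t₀)) (h0 : 0 < x t₀)
    (hc : c ≤ x t₀) (hA0 : 0 ≤ A t₀) {t : ℝ} (ht : t₀ ≤ t) :
    x t₀ + (t - t₀) / 2 ≤ x t := by
  have hAc := hA.continuous
  have hgrow : ∀ t, t₀ ≤ t → (∀ r ∈ Ico t₀ t, 0 < x r ∧ 0 < x r + 2 * A r) →
      x t₀ + (t - t₀) / 2 ≤ x t := by
    intro t ht h
    have := le_of_hasDerivAt_nonneg (f := fun r => x r - 1 / 2 * r)
      (f' := fun r => 1 + A r / max (x r) c - 1 / 2 * 1) ht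
      ((hxc.mono Icc_subset_Ici_self).sub (by fun_prop))
      (fun r hr => (hx r hr.1.le (h r ⟨hr.1.le, hr.2⟩).1).sub ((hasDerivAt_id r).const_mul _))
      (fun r hr => ?_)
    · linarith
    obtain ⟨h1, h2⟩ := h r ⟨hr.1.le, hr.2⟩
    have : -(1 / 2) ≤ A r / max (x r) c := by
      rw [le_div_iff₀ (lt_max_of_lt_left h1)]
      linarith [le_max_left (x r) c]
    linarith
  refine hgrow t ht fun r hr => ?_
  -- At the first exit time `x` is still positive, so the exit is through `x + 2 A = 0`.
  by_contra hr'
  have hxc' : ContinuousOn x (Icc t₀ r) := hxc.mono Icc_subset_Ici_self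
  have hK : IsCompact (Icc t₀ r ∩ (fun r => min (x r) (x r + 2 * A r)) ⁻¹' Iic 0) := by
    refine isCompact_Icc.of_isClosed_subset (ContinuousOn.preimage_isClosed_of_isClosed ?_
      isClosed_Icc isClosed_Iic) inter_subset_left
    exact hxc'.inf (hxc'.add (by fun_prop))
  obtain ⟨a, ⟨ha, ha0⟩, hleast⟩ := hK.exists_isLeast ⟨r, ⟨hr.1, le_rfl⟩, by
    rw [← lt_min_iff, not_lt] at hr'
    exact hr'⟩
  have hbefore : ∀ u ∈ Ico t₀ a, 0 < x u ∧ 0 < x u + 2 * A u := by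
    intro u hu
    rw [← lt_min_iff]
    by_contra! hu0
    linarith [hleast ⟨⟨hu.1, hu.2.le.trans ha.2⟩, hu0⟩, hu.2]
  have hxa : 0 < x a := by linarith [hgrow a ha.1 hbefore, ha.1]
  have hwa : x a + 2 * A a ≤ 0 := by
    rcases min_le_iff.1 (show min (x a) (x a + 2 * A a) ≤ 0 from ha0) with h | h
    · linarith
    · exact h
  have hta : t₀ < a := lt_of_le_of_ne ha.1 (by rintro rfl; linarith)
  have hder : HasDerivAt (fun u => x u + 2 * A u) (1 + A a / max (x a) c + 2 * deriv A a) a :=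
    (hx a ha.1 hxa).add ((hA.differentiable one_ne_zero a).hasDerivAt.const_mul 2)
  have hw0 : x a + 2 * A a = 0 := by
    refine le_antisymm hwa (ge_of_tendsto (hder.continuousAt.tendsto.mono_left
      (nhdsWithin_le_nhds (s := Iio a))) ?_)
    filter_upwards [Ioo_mem_nhdsLT hta] with u hu using (hbefore u ⟨hu.1.le, hu.2⟩).2.le
  have hAx : A a / max (x a) c = -(1 / 2) := by
    rw [max_eq_left (by linarith [hgrow a ha.1 hbefore, ha.1]), div_eq_iff hxa.ne']; linarith
  have hslope := (hasDerivAt_iff_tendsto_slope.1 hder).mono_left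
    (nhdsWithin_mono a (fun u (hu : u ∈ Iio a) => ne_of_lt hu))
  have hle : 1 + A a / max (x a) c + 2 * deriv A a ≤ 0 := by
    refine le_of_tendsto hslope ?_
    filter_upwards [Ioo_mem_nhdsLT hta] with u hu
    rw [slope_def_field, hw0]
    rw [sub_zero]
    exact div_nonpos_of_nonneg_of_nonpos (hbefore u ⟨hu.1.le, hu.2⟩).2.le (by linarith [hu.2])
  linarith [hmin a]

/-- A periodic solution cannot be positive where `A` is nonnegative, since it would grow at rate
`1 / 2` ever after; the reflected statement excludes negative values where `A` is nonpositive. -/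
theorem sign_eq_sign_neg_of_periodic {A y : ℝ → ℝ} {S : ℝ} (hA : ContDiff ℝ 1 A)
    (hmin : ∀ t, -(1 / 4 : ℝ) < deriv A t) (hS : 0 < S) (hy : IsAbelSolution A y)
    (hyper : Function.Periodic y S) (t : ℝ) :
    SignType.sign (y t) = SignType.sign (-(A t)) := by
  have key : ∀ (A y : ℝ → ℝ), ContDiff ℝ 1 A → (∀ t, -(1 / 4 : ℝ) < deriv A t) →
      IsAbelSolution A y → Function.Periodic y S → ∀ t, 0 ≤ A t → y t ≤ 0 := by
    intro A y hA hmin hy hyper t ht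
    by_contra! h
    have := add_half_le_of_pos (c := 0) hA hmin
      (fun r _ hr => by
        rw [max_eq_left hr.le]
        exact hasDerivAt_of_isAbelSolution hy hr.ne')
      hy.1.continuous.continuousOn h h.le ht (show t ≤ t + S by linarith)
    rw [hyper] at this
    linarith
  have h1 := key A y hA hmin hy hyper t
  have h2 := key (fun t => -A (-t)) (fun t => -y (-t)) (hA.comp contDiff_neg).neg
    (fun t => by rw [deriv_neg_comp_neg]; exact hmin _) (isAbelSolution_reflect hy)
    (fun t => by simp only [neg_add', hyper.sub_eq]) (-t)
  simp only [neg_neg] at h2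
  have h3 := hy.2 t
  rcases lt_trichotomy (A t) 0 with h | h | h
  · have : y t ≠ 0 := fun h0 => by rw [h0] at h3; linarith
    have : 0 < y t := lt_of_le_of_ne (by linarith [h2 (by linarith)]) this.symm
    rw [sign_pos this, sign_pos (by linarith)]
  · have : y t = 0 := le_antisymm (h1 h.ge) (by linarith [h2 (by linarith)])
    rw [this, h, neg_zero]
  · have : y t ≠ 0 := fun h0 => by rw [h0] at h3; linarith
    have : y t < 0 := lt_of_le_of_ne (h1 h.le) this
    rw [sign_neg this, sign_neg (by linarith)]

/-- A solution started slightly above a zero of `A` grows linearly, away from any bounded one. -/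
theorem isAbelUnstable_of_bounded {A x : ℝ → ℝ} {t₀ M C : ℝ} (hA : ContDiff ℝ 1 A)
    (hmin : ∀ t, -(1 / 4 : ℝ) < deriv A t) (hM : ∀ t, |A t| ≤ M) (h0 : A t₀ = 0) (hx0 : x t₀ = 0)
    (hC : ∀ t, |x t| ≤ C) : IsAbelUnstable A x := by
  refine ⟨t₀, 1, one_pos, fun δ hδ => ?_⟩
  obtain ⟨y, hy0, hy⟩ := exists_truncated_solution hA.continuous hM (half_pos hδ) 1 t₀ (δ / 2)
  have hyc : Continuous y := continuous_iff_continuousAt.2 fun t => (hy t).continuousAt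
  have hgrow : ∀ t, t₀ ≤ t → δ / 2 + (t - t₀) / 2 ≤ y t := fun t ht => by
    have := add_half_le_of_pos hA hmin (fun r _ _ => hy r) hyc.continuousOn (by linarith) hy0.ge
      h0.ge ht
    rwa [hy0] at this
  have hy' : ∀ t, t₀ ≤ t → 0 < y t ∧ HasDerivAt y (1 + A t / y t) t := fun t ht => by
    have h1 := hgrow t ht
    have h2 := hy t
    rw [max_eq_left (by linarith)] at h2
    exact ⟨by linarith, h2⟩
  refine ⟨y, ⟨fun t ht => (hy t).differentiableAt.differentiableWithinAt, fun t ht => ?_⟩, ?_,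
    t₀ + 2 * (C + 1), ?_, ?_⟩
  · obtain ⟨h1, h2⟩ := hy' t ht
    rw [h2.hasDerivWithinAt.derivWithin (uniqueDiffOn_Ici t₀ t ht)]
    field_simp
    ring
  · rw [hy0, hx0, sub_zero, abs_of_pos (by linarith)]
    linarith
  · linarith [(abs_nonneg _).trans (hC t₀)]
  · have h1 := hgrow (t₀ + 2 * (C + 1)) (by linarith [(abs_nonneg _).trans (hC t₀)])
    have h2 := (abs_le.1 (hC (t₀ + 2 * (C + 1)))).2
    exact le_trans (by linarith) (le_abs_self _)

end AbelSecondKind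

theorem proposition4 (T : ℝ) (hT : 0 < T) (A : ℝ → ℝ)
    (hA : ContDiff ℝ 1 A) (hper : Function.Periodic A T)
    (hzero : ∃ t ∈ Set.Icc 0 T, A t = 0)
    (hmin : ∀ t, -(1 / 4 : ℝ) < deriv A t) :
    ∃ xs : ℝ → ℝ,
      IsAbelSolution A xs ∧ Function.Periodic xs T ∧ ContDiff ℝ 1 xs ∧
      (∀ t, SignType.sign (xs t) = SignType.sign (-(A t))) ∧
      IsAbelUnstable A xs ∧
      ((∀ t, A t = 0 → deriv A t ≠ 0) →
        ¬ HasConstantSign xs ∧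
        ∀ y : ℝ → ℝ, IsAbelSolution A y → Function.Periodic y T → ¬ HasConstantSign y →
          y = xs) ∧
      ((∫ t in (0 : ℝ)..T, A t) = 0 →
        ∀ S : ℝ, 0 < S → ∀ y : ℝ → ℝ, IsAbelSolution A y → Function.Periodic y S →
          y = xs) := by
  obtain ⟨z, -, hz⟩ := hzero
  obtain ⟨x, hx, hx1, hsign⟩ := AbelSecondKind.exists_solution_sign_neg hT hA hper hz hmin
  have hxz : x z = 0 := by
    have := hsign z
    rwa [hz, neg_zero, sign_zero, sign_eq_zero_iff] at this
  have hxper : Function.Periodic x T := by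
    have hshift : IsAbelSolution A fun t => x (t + T) := by
      refine ⟨hx.1.comp (differentiable_id.add_const T), fun t => ?_⟩
      rw [deriv_comp_add_const, hx.2 (t + T), hper t]
    have := AbelSecondKind.eq_of_sign_neg hT hA.continuous hper hz hshift hx
      (fun t => by rw [hsign (t + T), hper t]) hsign
    exact fun t => congrFun this t
  have huniq : ∀ S : ℝ, 0 < S → ∀ y : ℝ → ℝ, IsAbelSolution A y → Function.Periodic y S →
      y = x := fun S hS y hy hyper =>
    AbelSecondKind.eq_of_sign_neg hT hA.continuous hper hz hy hx
      (AbelSecondKind.sign_eq_sign_neg_of_periodic hA hmin hS hy hyper) hsign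
  obtain ⟨M, hM⟩ := AbelSecondKind.exists_bound_of_periodic hT hA hper
  obtain ⟨C, hC⟩ := AbelSecondKind.exists_bound_of_periodic hT hx1 hxper
  refine ⟨x, hx, hxper, hx1, hsign, AbelSecondKind.isAbelUnstable_of_bounded hA hmin
    (fun t => (hM t).1) hz hxz fun t => (hC t).1, fun _ => ⟨?_, ?_⟩, fun _ => huniq⟩
  · rintro (h | h)
    · exact (h z).ne' hxz
    · exact (h z).ne hxz
  · exact fun y hy hyper _ => huniq T hT y hy hyper
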